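/- Let $0<q<1$ and $(a;q)_\infty=\prod_{k=0}^{\infty}(1-q^k a)$. For $x>0$ let $$\Gamma_q(x)=\frac{(q;q)_\infty}{(q^x;q)_\infty}(1-q)^{1-x}$$ be the $q$-gamma function, and for $\alpha,\beta>0$ and real $z$ with $|z(1-q)^\alpha|<1$ let $$e_{\alpha,\beta}(z;q)=\sum_{k=0}^{\infty}\frac{z^k}{\Gamma_q(\alpha k+\beta)}$$ be the $q$-Mittag-Leffler function. If $0<\alpha<1$, $z>0$ and $|z(1-q)^\alpha|<1$, then $$\frac{1}{1+\Gamma_q(1-\alpha)\,z}\;\le\; e_{\alpha,1}(-z;q)\;\le\;\frac{1}{1+\Gamma_q(\alpha+1)^{-1}z}.$$ In particular, $0<e_{\alpha,1}(-z;q)<1$. -/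

import Mathlib

/-- The infinite `q`-shifted factorial `(a; q)_∞ = ∏_{k ≥ 0} (1 - q ^ k a)`. -/
noncomputable def qShiftedFactorial (a q : ℝ) : ℝ :=
  ∏' k : ℕ, (1 - q ^ k * a)

/-- For `0 < q < 1` the infinite product is the limit of the finite `q`-shifted factorials. -/
theorem tendsto_qShiftedFactorial (a : ℝ) {q : ℝ} (hq0 : 0 < q) (hq1 : q < 1) :
    Filter.Tendsto (fun n : ℕ => ∏ k ∈ Finset.range n, (1 - q ^ k * a)) Filter.atTop
      (nhds (qShiftedFactorial a q)) := by
  have hs : Summable fun k : ℕ => ‖-(q ^ k * a)‖ := by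
    have h := ((summable_geometric_of_lt_one hq0.le hq1).mul_right a).norm
    simpa only [norm_neg] using h
  have hm := multipliable_one_add_of_summable hs
  simpa [qShiftedFactorial, sub_eq_add_neg] using hm.hasProd.tendsto_prod_nat

/-- The `q`-gamma function `Γ_q(x) = (q; q)_∞ / (q ^ x; q)_∞ * (1 - q) ^ (1 - x)`, for `x > 0`. -/
noncomputable def qGamma (q x : ℝ) : ℝ :=
  qShiftedFactorial q q / qShiftedFactorial (q ^ x) q * (1 - q) ^ (1 - x)

/-- The `q`-Mittag-Leffler function `e_{α,β}(z; q) = ∑_{k ≥ 0} z ^ k / Γ_q(α k + β)`,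
for real arguments with `|z (1 - q) ^ α| < 1` (the domain of convergence of the series). -/
noncomputable def qMittagLeffler (α β z q : ℝ) : ℝ :=
  ∑' k : ℕ, z ^ k / qGamma q (α * k + β)

/-! The substitution `x = z (1 - q) ^ α` turns `e_{α,1}(-z; q)` into
`U(x) = ∑ (-x) ^ k (q ^ (1 + α k); q)_∞ / (q; q)_∞`, a convergent series for `0 ≤ x < 1`. Write
`p = q ^ α`. The `q`-binomial theorem `∑ (a; q)_n / (q; q)_n y ^ n = (a y; q)_∞ / (y; q)_∞`,
applied at `y = q p ^ k` and `a = q ^ (±α)`, shows that the weighted sums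
`∑ (q ^ (±α); q)_n / (q; q)_n q ^ n U(p ^ n x)` shift the coefficients of `U` by one step
(`hasSum_qBinomialCoeff_mul_rescaledMittagLeffler`, `rescaledMittagLeffler_eq_sub`). These are
`q`-fractional integral and relaxation equations:

* `U(x) = 1 - x ∑ a_n U(p ^ n x)` with `a_n ≥ 0` and `∑ a_n = (q ^ (1 + α); q)_∞ / (q; q)_∞`;
* `(1 + x) U(x) = d + ∑ b_n U(p ^ (n + 1) x)` with `b_n ≥ 0`, `∑ b_n = 1 - d` and
  `d = (q ^ (1 - α); q)_∞ / (q; q)_∞` (`exists_relaxation_weights`).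

Since `U(p ^ m x) → 1`, a minimum principle for the second equation gives `U ≥ 0`, and then, for the
differences `U(p ^ (m + 1) x) - U(p ^ m x) → 0`, that `U(p ^ m x)` increases with `m`. Replacing each
`U(p ^ n x)` on the right of the two equations by the smaller `U(x)` gives the upper and the lower
bound respectively. -/

/-! ### The infinite `q`-shifted factorial -/

theorem qShiftedFactorial_pos {a q : ℝ} (hq0 : 0 < q) (hq1 : q < 1) (ha1 : a < 1) :
    0 < qShiftedFactorial a q := by
  have hs : Summable fun k : ℕ => -(q ^ k * a) :=
    ((summable_geometric_of_lt_one hq0.le hq1).mul_right a).neg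
  have hpos : ∀ k : ℕ, 0 < 1 + -(q ^ k * a) := fun k => by
    have h1 : q ^ k ≤ 1 := pow_le_one₀ hq0.le hq1.le
    have h2 : 0 < q ^ k := pow_pos hq0 k
    nlinarith
  have h := Real.rexp_tsum_eq_tprod hpos (Real.summable_log_one_add_of_summable hs)
  simp only [qShiftedFactorial, sub_eq_add_neg]
  rw [← h]
  exact Real.exp_pos _

theorem qShiftedFactorial_le_one {a q : ℝ} (hq0 : 0 < q) (hq1 : q < 1) (ha0 : 0 ≤ a)
    (ha1 : a ≤ 1) : qShiftedFactorial a q ≤ 1 := by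
  refine le_of_tendsto (tendsto_qShiftedFactorial a hq0 hq1) (Filter.Eventually.of_forall fun n => ?_)
  refine Finset.prod_le_one (fun k _ => ?_) fun k _ => ?_
  · have h1 : q ^ k ≤ 1 := pow_le_one₀ hq0.le hq1.le
    have h2 : 0 < q ^ k := pow_pos hq0 k
    nlinarith
  · have : 0 ≤ q ^ k * a := by positivity
    linarith

/-- The quotient `(q ^ t; q)_∞ / (q; q)_∞`, that is, `1 / Γ_q(t)` without the power of `1 - q`. -/
noncomputable def qFactorialRatio (q t : ℝ) : ℝ :=
  qShiftedFactorial (q ^ t) q / qShiftedFactorial q q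

theorem qFactorialRatio_one {q : ℝ} (hq0 : 0 < q) (hq1 : q < 1) : qFactorialRatio q 1 = 1 := by
  rw [qFactorialRatio, Real.rpow_one, div_self (qShiftedFactorial_pos hq0 hq1 hq1).ne']

theorem qFactorialRatio_pos {q t : ℝ} (hq0 : 0 < q) (hq1 : q < 1) (ht : 0 < t) :
    0 < qFactorialRatio q t :=
  div_pos (qShiftedFactorial_pos hq0 hq1 (Real.rpow_lt_one hq0.le hq1 ht))
    (qShiftedFactorial_pos hq0 hq1 hq1)

theorem qFactorialRatio_le {q t : ℝ} (hq0 : 0 < q) (hq1 : q < 1) (ht : 0 < t) :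
    qFactorialRatio q t ≤ 1 / qShiftedFactorial q q :=
  div_le_div_of_nonneg_right (qShiftedFactorial_le_one hq0 hq1 (Real.rpow_pos_of_pos hq0 t).le
    (Real.rpow_lt_one hq0.le hq1 ht).le) (qShiftedFactorial_pos hq0 hq1 hq1).le

theorem inv_qGamma {q : ℝ} (hq1 : q < 1) (t : ℝ) :
    (qGamma q t)⁻¹ = qFactorialRatio q t * (1 - q) ^ (t - 1) := by
  rw [qGamma, qFactorialRatio, mul_inv, inv_div, ← Real.rpow_neg (by linarith), neg_sub]

/-! ### The `q`-binomial theorem -/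

/-- The coefficient `(a; q)_n / (q; q)_n` of the `q`-binomial series. -/
noncomputable def qBinomialCoeff (a q : ℝ) (n : ℕ) : ℝ :=
  ∏ j ∈ Finset.range n, (1 - q ^ j * a) / (1 - q ^ (j + 1))

theorem qBinomialCoeff_zero (a q : ℝ) : qBinomialCoeff a q 0 = 1 := by
  simp [qBinomialCoeff]

theorem qBinomialCoeff_succ (a q : ℝ) (n : ℕ) :
    qBinomialCoeff a q (n + 1) = qBinomialCoeff a q n * ((1 - q ^ n * a) / (1 - q ^ (n + 1))) := by
  rw [qBinomialCoeff, Finset.prod_range_succ, qBinomialCoeff]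

theorem qBinomialCoeff_succ_mul {q : ℝ} (hq0 : 0 < q) (hq1 : q < 1) (a : ℝ) (n : ℕ) :
    qBinomialCoeff a q (n + 1) * (1 - q ^ (n + 1)) = qBinomialCoeff a q n * (1 - q ^ n * a) := by
  have : q ^ (n + 1) < 1 := pow_lt_one₀ hq0.le hq1 n.succ_ne_zero
  rw [qBinomialCoeff_succ, mul_assoc, div_mul_cancel₀ _ (by linarith)]

theorem qBinomialCoeff_nonneg {a q : ℝ} (hq0 : 0 < q) (hq1 : q < 1) (ha0 : 0 ≤ a) (ha1 : a ≤ 1)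
    (n : ℕ) : 0 ≤ qBinomialCoeff a q n := by
  refine Finset.prod_nonneg fun j _ => div_nonneg ?_ ?_
  · have := mul_le_one₀ (pow_le_one₀ hq0.le hq1.le : q ^ j ≤ 1) ha0 ha1
    linarith
  · have : q ^ (j + 1) < 1 := pow_lt_one₀ hq0.le hq1 j.succ_ne_zero
    linarith

/-- For `1 ≤ a ≤ q⁻¹` only the first factor of `(a; q)_n` is negative. -/
theorem qBinomialCoeff_succ_nonpos {a q : ℝ} (hq0 : 0 < q) (hq1 : q < 1) (ha1 : 1 ≤ a)
    (haq : q * a ≤ 1) (n : ℕ) : qBinomialCoeff a q (n + 1) ≤ 0 := by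
  rw [qBinomialCoeff, Finset.prod_range_succ']
  refine mul_nonpos_of_nonneg_of_nonpos (Finset.prod_nonneg fun j _ => div_nonneg ?_ ?_)
    (div_nonpos_of_nonpos_of_nonneg ?_ ?_)
  · have h1 : q ^ j ≤ 1 := pow_le_one₀ hq0.le hq1.le
    have h3 : q ^ j * (q * a) ≤ 1 := mul_le_one₀ h1 (by positivity) haq
    rw [pow_succ, mul_assoc]
    linarith
  · have : q ^ (j + 1 + 1) < 1 := pow_lt_one₀ hq0.le hq1 (Nat.succ_ne_zero _)
    linarith
  · simpa using ha1
  · simpa using hq1.le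

theorem summable_qBinomialCoeff_mul_pow {q y : ℝ} (hq0 : 0 < q) (hq1 : q < 1) (hy : |y| < 1)
    (a : ℝ) : Summable fun n => qBinomialCoeff a q n * y ^ n := by
  obtain ⟨r, hr1, hr2⟩ := exists_between hy
  have hp : Filter.Tendsto (fun n : ℕ => q ^ n) Filter.atTop (nhds 0) :=
    tendsto_pow_atTop_nhds_zero_of_lt_one hq0.le hq1
  have hlim : Filter.Tendsto (fun n : ℕ => |(1 - q ^ n * a) / (1 - q ^ (n + 1)) * y|) Filter.atTop
      (nhds |(1 - 0 * a) / (1 - 0) * y|) :=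
    ((((hp.mul_const a).const_sub 1).div
      (((Filter.tendsto_add_atTop_iff_nat 1).2 hp).const_sub 1) (by norm_num)).mul_const y).abs
  have hlim' : |(1 - 0 * a) / (1 - 0) * y| < r := by simpa using hr1
  refine summable_of_ratio_norm_eventually_le hr2 ?_
  filter_upwards [hlim.eventually_le_const hlim'] with n hn
  rw [qBinomialCoeff_succ, pow_succ, Real.norm_eq_abs, Real.norm_eq_abs]
  calc |qBinomialCoeff a q n * ((1 - q ^ n * a) / (1 - q ^ (n + 1))) * (y ^ n * y)|
      = |(1 - q ^ n * a) / (1 - q ^ (n + 1)) * y| * |qBinomialCoeff a q n * y ^ n| := by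
        rw [← abs_mul]; congr 1; ring
    _ ≤ r * |qBinomialCoeff a q n * y ^ n| := by gcongr

/-- The functional equation of the `q`-binomial series. -/
theorem tsum_qBinomialCoeff_functional_equation {q y : ℝ} (hq0 : 0 < q) (hq1 : q < 1)
    (hy : |y| < 1) (a : ℝ) :
    (1 - y) * ∑' n, qBinomialCoeff a q n * y ^ n =
      (1 - a * y) * ∑' n, qBinomialCoeff a q n * (q * y) ^ n := by
  have hqy : |q * y| < 1 := by
    rw [abs_mul, abs_of_pos hq0]
    nlinarith [abs_nonneg y]
  have h1 := summable_qBinomialCoeff_mul_pow hq0 hq1 hy a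
  have h2 := summable_qBinomialCoeff_mul_pow hq0 hq1 hqy a
  have key : (∑' n, qBinomialCoeff a q n * y ^ n) - ∑' n, qBinomialCoeff a q n * (q * y) ^ n =
      y * (∑' n, qBinomialCoeff a q n * y ^ n) -
        a * y * ∑' n, qBinomialCoeff a q n * (q * y) ^ n := by
    rw [← h1.tsum_sub h2, (h1.sub h2).tsum_eq_zero_add, ← tsum_mul_left, ← tsum_mul_left,
      ← (h1.mul_left y).tsum_sub (h2.mul_left (a * y))]
    simp only [pow_zero, sub_self, zero_add]
    refine tsum_congr fun n => ?_
    have := qBinomialCoeff_succ_mul hq0 hq1 a n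
    rw [mul_pow, mul_pow]
    linear_combination y ^ (n + 1) * this
  linear_combination key

/-- The `q`-binomial theorem, in product form. -/
theorem qShiftedFactorial_mul_tsum_qBinomialCoeff {q y : ℝ} (hq0 : 0 < q) (hq1 : q < 1)
    (hy : |y| < 1) (a : ℝ) :
    qShiftedFactorial y q * ∑' n, qBinomialCoeff a q n * y ^ n = qShiftedFactorial (a * y) q := by
  have hle : ∀ m : ℕ, |q ^ m * y| ≤ |y| := fun m => by
    rw [abs_mul, abs_of_pos (pow_pos hq0 m)]
    exact mul_le_of_le_one_left (abs_nonneg y) (pow_le_one₀ hq0.le hq1.le)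
  have hit : ∀ m : ℕ, (∏ k ∈ Finset.range m, (1 - q ^ k * y)) *
      (∑' n, qBinomialCoeff a q n * y ^ n) =
      (∏ k ∈ Finset.range m, (1 - q ^ k * (a * y))) *
        ∑' n, qBinomialCoeff a q n * (q ^ m * y) ^ n := by
    intro m
    induction m with
    | zero => simp
    | succ m ih =>
      have h := tsum_qBinomialCoeff_functional_equation hq0 hq1 ((hle m).trans_lt hy) a
      rw [Finset.prod_range_succ, Finset.prod_range_succ, pow_succ']
      simp only [← mul_assoc] at h ih ⊢
      linear_combination (1 - q ^ m * y) * ih +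
        (∏ k ∈ Finset.range m, (1 - q ^ k * a * y)) * h
  have hlim : Filter.Tendsto (fun m : ℕ => ∑' n, qBinomialCoeff a q n * (q ^ m * y) ^ n)
      Filter.atTop (nhds (∑' n, qBinomialCoeff a q n * 0 ^ n)) := by
    refine tendsto_tsum_of_dominated_convergence
      (summable_qBinomialCoeff_mul_pow hq0 hq1 hy a).norm (fun n => ?_)
      (Filter.Eventually.of_forall fun m n => ?_)
    · have hp := (tendsto_pow_atTop_nhds_zero_of_lt_one hq0.le hq1).mul_const y
      rw [zero_mul] at hp
      exact (hp.pow n).const_mul _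
    · rw [norm_mul, norm_mul, norm_pow, norm_pow]
      have := hle m
      gcongr
      exact this
  have hone : ∑' n, qBinomialCoeff a q n * 0 ^ n = 1 := by
    rw [tsum_eq_single 0 fun n hn => by simp [hn]]
    simp [qBinomialCoeff_zero]
  rw [hone] at hlim
  have hL := (tendsto_qShiftedFactorial y hq0 hq1).mul_const (∑' n, qBinomialCoeff a q n * y ^ n)
  have hR := (tendsto_qShiftedFactorial (a * y) hq0 hq1).mul hlim
  rw [mul_one] at hR
  exact tendsto_nhds_unique hL (hR.congr fun m => (hit m).symm)

theorem tsum_qBinomialCoeff_mul_qFactorialRatio {q s t : ℝ} (hq0 : 0 < q) (hq1 : q < 1)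
    (ht : 0 < t) :
    (∑' n, qBinomialCoeff (q ^ s) q n * (q ^ t) ^ n) * qFactorialRatio q t =
      qFactorialRatio q (s + t) := by
  have hy : |q ^ t| < 1 := by
    rw [abs_of_pos (Real.rpow_pos_of_pos hq0 t)]
    exact Real.rpow_lt_one hq0.le hq1 ht
  have h := qShiftedFactorial_mul_tsum_qBinomialCoeff hq0 hq1 hy (q ^ s)
  rw [← Real.rpow_add hq0] at h
  rw [qFactorialRatio, qFactorialRatio, ← h]
  ring

/-! ### The rescaled Mittag-Leffler function and its `q`-fractional equations -/

/-- The series `∑ (-x) ^ k (q ^ (1 + s + α k); q)_∞ / (q; q)_∞`. For `s = 0` this is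
`e_{α,1}(-z; q)` in the variable `x = z (1 - q) ^ α`; a `q`-fractional integral (derivative) of
order `α` produces the series with `s = α` (`s = -α`). -/
noncomputable def rescaledMittagLeffler (q α s x : ℝ) : ℝ :=
  ∑' k : ℕ, (-x) ^ k * qFactorialRatio q (1 + s + α * k)

theorem qMittagLeffler_neg_eq {q : ℝ} (hq1 : q < 1) (α z : ℝ) :
    qMittagLeffler α 1 (-z) q = rescaledMittagLeffler q α 0 (z * (1 - q) ^ α) := by
  refine tsum_congr fun k => ?_
  rw [div_eq_mul_inv, inv_qGamma hq1, add_sub_cancel_right, Real.rpow_mul_natCast (by linarith),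
    ← neg_mul, mul_pow, add_zero, add_comm (1 : ℝ)]
  ring

theorem norm_rescaledMittagLeffler_term_le {q α s x r : ℝ} (hq0 : 0 < q) (hq1 : q < 1)
    (hα : 0 ≤ α) (hs : 0 < 1 + s) (hx : |x| ≤ r) (k : ℕ) :
    ‖(-x) ^ k * qFactorialRatio q (1 + s + α * k)‖ ≤ r ^ k * (1 / qShiftedFactorial q q) := by
  have ht : 0 < 1 + s + α * k := by positivity
  rw [norm_mul, norm_pow, norm_neg, Real.norm_eq_abs, Real.norm_eq_abs,
    abs_of_pos (qFactorialRatio_pos hq0 hq1 ht)]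
  have := qFactorialRatio_le hq0 hq1 ht
  have := qFactorialRatio_pos hq0 hq1 ht
  have := (abs_nonneg x).trans hx
  gcongr

theorem summable_rescaledMittagLeffler {q α s x : ℝ} (hq0 : 0 < q) (hq1 : q < 1)
    (hα : 0 ≤ α) (hs : 0 < 1 + s) (hx : |x| < 1) :
    Summable fun k : ℕ => (-x) ^ k * qFactorialRatio q (1 + s + α * k) :=
  .of_norm_bounded ((summable_geometric_of_lt_one (abs_nonneg x) hx).mul_right _)
    (norm_rescaledMittagLeffler_term_le hq0 hq1 hα hs le_rfl)

theorem rescaledMittagLeffler_zero (q α s : ℝ) :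
    rescaledMittagLeffler q α s 0 = qFactorialRatio q (1 + s) := by
  rw [rescaledMittagLeffler, tsum_eq_single 0 fun n hn => by simp [hn]]
  simp

theorem rescaledMittagLeffler_eq_sub {q α s x : ℝ} (hq0 : 0 < q) (hq1 : q < 1)
    (hα : 0 ≤ α) (hs : 0 < 1 + s) (hx : |x| < 1) :
    rescaledMittagLeffler q α s x =
      qFactorialRatio q (1 + s) - x * rescaledMittagLeffler q α (s + α) x := by
  rw [rescaledMittagLeffler, (summable_rescaledMittagLeffler hq0 hq1 hα hs hx).tsum_eq_zero_add,
    rescaledMittagLeffler, sub_eq_add_neg, ← neg_mul, ← tsum_mul_left]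
  congr 1
  · simp
  · refine tsum_congr fun k => ?_
    rw [show 1 + s + α * ((k + 1 : ℕ) : ℝ) = 1 + (s + α) + α * k by push_cast; ring]
    ring

theorem tendsto_rescaledMittagLeffler {q α s x p : ℝ} (hq0 : 0 < q) (hq1 : q < 1)
    (hα : 0 ≤ α) (hs : 0 < 1 + s) (hx : |x| < 1) (hp0 : 0 ≤ p) (hp1 : p < 1) :
    Filter.Tendsto (fun m : ℕ => rescaledMittagLeffler q α s (p ^ m * x)) Filter.atTop
      (nhds (qFactorialRatio q (1 + s))) := by
  rw [← rescaledMittagLeffler_zero q α s]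
  refine tendsto_tsum_of_dominated_convergence
    ((summable_geometric_of_lt_one (abs_nonneg x) hx).mul_right (1 / qShiftedFactorial q q))
    (fun k => ?_) (Filter.Eventually.of_forall fun m k => ?_)
  · have hp := (tendsto_pow_atTop_nhds_zero_of_lt_one hp0 hp1).mul_const x
    rw [zero_mul] at hp
    exact (hp.neg.pow k).mul_const _
  · refine norm_rescaledMittagLeffler_term_le hq0 hq1 hα hs ?_ k
    rw [abs_mul, abs_of_nonneg (pow_nonneg hp0 m)]
    exact mul_le_of_le_one_left (abs_nonneg x) (pow_le_one₀ hp0 hp1.le)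

/-- The `q`-fractional integral (`s > 0`) or derivative (`s < 0`) of the rescaled Mittag-Leffler
function, as a weighted sum over the points `q ^ (α n) x`; the `q`-binomial theorem computes it
term by term. -/
theorem hasSum_qBinomialCoeff_mul_rescaledMittagLeffler {q α s x : ℝ} (hq0 : 0 < q) (hq1 : q < 1)
    (hα : 0 ≤ α) (hx : |x| < 1) :
    HasSum (fun n : ℕ => qBinomialCoeff (q ^ s) q n * q ^ n *
        rescaledMittagLeffler q α 0 ((q ^ α) ^ n * x))
      (rescaledMittagLeffler q α s x) := by
  have hp0 : 0 < q ^ α := Real.rpow_pos_of_pos hq0 α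
  have hp1 : q ^ α ≤ 1 := Real.rpow_le_one hq0.le hq1.le hα
  have hA := (summable_qBinomialCoeff_mul_pow hq0 hq1 (by rwa [abs_of_pos hq0]) (q ^ s)).norm
  have hB := (summable_geometric_of_lt_one (abs_nonneg x) hx).mul_right
    (1 / qShiftedFactorial q q)
  have hF : Summable (Function.uncurry fun n k : ℕ => qBinomialCoeff (q ^ s) q n * q ^ n *
      ((-((q ^ α) ^ n * x)) ^ k * qFactorialRatio q (1 + 0 + α * k))) := by
    refine .of_norm_bounded (hA.mul_of_nonneg hB (fun _ => norm_nonneg _) fun k => ?_) ?_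
    · have := qShiftedFactorial_pos hq0 hq1 hq1
      positivity
    · rintro ⟨n, k⟩
      rw [Function.uncurry_apply_pair, norm_mul]
      refine mul_le_mul_of_nonneg_left ?_ (norm_nonneg _)
      refine norm_rescaledMittagLeffler_term_le hq0 hq1 hα (by norm_num) ?_ k
      rw [abs_mul, abs_of_nonneg (pow_nonneg hp0.le n)]
      exact mul_le_of_le_one_left (abs_nonneg x) (pow_le_one₀ hp0.le hp1)
  have hin : ∀ n : ℕ, ∑' k : ℕ, qBinomialCoeff (q ^ s) q n * q ^ n *
      ((-((q ^ α) ^ n * x)) ^ k * qFactorialRatio q (1 + 0 + α * k)) =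
      qBinomialCoeff (q ^ s) q n * q ^ n *
        rescaledMittagLeffler q α 0 ((q ^ α) ^ n * x) := fun n => tsum_mul_left
  have hS := hF.prod
  simp only [Function.uncurry_apply_pair, hin] at hS
  rw [hS.hasSum_iff, ← tsum_congr hin, ← hF.tsum_comm, rescaledMittagLeffler]
  refine tsum_congr fun k => ?_
  have ht : 0 < 1 + α * k := by positivity
  have hqt : q ^ (1 + α * k) = q * (q ^ α) ^ k := by
    rw [Real.rpow_add hq0, Real.rpow_one, Real.rpow_mul_natCast hq0.le]
  rw [show 1 + s + α * k = s + (1 + α * k) by ring,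
    ← tsum_qBinomialCoeff_mul_qFactorialRatio hq0 hq1 ht, ← tsum_mul_right, ← tsum_mul_left, hqt]
  refine tsum_congr fun n => ?_
  rw [add_zero, mul_pow q, ← pow_mul, ← mul_neg, mul_pow _ (-x), ← pow_mul, mul_comm k n]
  ring

/-! ### Positivity and monotonicity along `q ^ (α m) x` -/

/-- A minimum principle: a sequence with nonnegative limit that took a negative value would attain
a negative minimum. -/
theorem nonneg_of_tendsto_of_not_min {u : ℕ → ℝ} {L : ℝ}
    (hu : Filter.Tendsto u Filter.atTop (nhds L)) (hL : 0 ≤ L)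
    (hmin : ∀ m, (∀ n, u m ≤ u n) → 0 ≤ u m) (m : ℕ) : 0 ≤ u m := by
  by_contra! hm
  obtain ⟨N, hN⟩ := Filter.eventually_atTop.1 (hu.eventually_const_lt (hm.trans_le hL))
  obtain ⟨M, -, hM⟩ := Finset.exists_min_image (Finset.range (N + m + 1)) u ⟨m, by simp⟩
  have hMm : u M ≤ u m := hM m (by simp)
  have hall : ∀ n, u M ≤ u n := fun n => by
    rcases lt_or_ge n (N + m + 1) with h | h
    · exact hM n (Finset.mem_range.2 h)
    · exact hMm.trans (hN n (by omega)).le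
  linarith [hmin M hall]

/-- The relaxation equation: a fractional difference of order `α` of the rescaled Mittag-Leffler
function is a multiple of it. All weights apart from the leading one are moved to one side, where
they are nonnegative with total mass `1 - (q ^ (1 - α); q)_∞ / (q; q)_∞`. -/
theorem exists_relaxation_weights {q α : ℝ} (hq0 : 0 < q) (hq1 : q < 1) (hα0 : 0 < α)
    (hα1 : α < 1) :
    ∃ b : ℕ → ℝ, (∀ n, 0 ≤ b n) ∧ HasSum b (1 - qFactorialRatio q (1 - α)) ∧
      ∀ x : ℝ, |x| < 1 →
        HasSum (fun n : ℕ => b n * rescaledMittagLeffler q α 0 ((q ^ α) ^ (n + 1) * x))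
          ((1 + x) * rescaledMittagLeffler q α 0 x - qFactorialRatio q (1 - α)) := by
  have key : ∀ x : ℝ, |x| < 1 →
      HasSum (fun n : ℕ => -(qBinomialCoeff (q ^ (-α)) q (n + 1) * q ^ (n + 1)) *
          rescaledMittagLeffler q α 0 ((q ^ α) ^ (n + 1) * x))
        ((1 + x) * rescaledMittagLeffler q α 0 x - qFactorialRatio q (1 - α)) := by
    intro x hx
    have h := (hasSum_nat_add_iff' 1).2
      (hasSum_qBinomialCoeff_mul_rescaledMittagLeffler (s := -α) hq0 hq1 hα0.le hx)
    rw [rescaledMittagLeffler_eq_sub hq0 hq1 hα0.le (by linarith) hx, neg_add_cancel] at h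
    have hval : (1 + x) * rescaledMittagLeffler q α 0 x - qFactorialRatio q (1 - α) =
        -(qFactorialRatio q (1 + -α) - x * rescaledMittagLeffler q α 0 x -
          ∑ i ∈ Finset.range 1, qBinomialCoeff (q ^ (-α)) q i * q ^ i *
            rescaledMittagLeffler q α 0 ((q ^ α) ^ i * x)) := by
      simp only [Finset.sum_range_one, qBinomialCoeff_zero, pow_zero, one_mul, ← sub_eq_add_neg]
      ring
    rw [hval]
    simpa only [neg_mul] using h.neg
  refine ⟨_, fun n => ?_, ?_, key⟩
  · refine neg_nonneg.2 (mul_nonpos_of_nonpos_of_nonneg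
      (qBinomialCoeff_succ_nonpos hq0 hq1 ?_ ?_ n) (by positivity))
    · exact Real.one_le_rpow_of_pos_of_le_one_of_nonpos hq0 hq1.le (by linarith)
    · rw [← Real.rpow_one_add' hq0.le (by linarith)]
      exact Real.rpow_le_one hq0.le hq1.le (by linarith)
  · have h := key 0 (by simp)
    simpa [rescaledMittagLeffler_zero, qFactorialRatio_one hq0 hq1] using h

theorem rescaledMittagLeffler_nonneg {q α x : ℝ} (hq0 : 0 < q) (hq1 : q < 1) (hα0 : 0 < α)
    (hα1 : α < 1) (hx0 : 0 ≤ x) (hx1 : x < 1) : 0 ≤ rescaledMittagLeffler q α 0 x := by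
  obtain ⟨b, hb0, hb, hrel⟩ := exists_relaxation_weights hq0 hq1 hα0 hα1
  have hp0 : 0 < q ^ α := Real.rpow_pos_of_pos hq0 α
  have hp1 : q ^ α < 1 := Real.rpow_lt_one hq0.le hq1 hα0
  have hd := qFactorialRatio_pos hq0 hq1 (show 0 < 1 - α by linarith)
  have hxa : |x| < 1 := by rwa [abs_of_nonneg hx0]
  have hlim := tendsto_rescaledMittagLeffler (s := 0) hq0 hq1 hα0.le (by norm_num) hxa hp0.le hp1
  have h0 := nonneg_of_tendsto_of_not_min hlim
    (qFactorialRatio_pos hq0 hq1 (by norm_num)).le (fun m hmin => ?_) 0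
  · simpa using h0
  · have hpx : 0 ≤ (q ^ α) ^ m * x := by positivity
    have hpx1 : |(q ^ α) ^ m * x| < 1 := by
      rw [abs_of_nonneg hpx]
      exact (mul_le_of_le_one_left hx0 (pow_le_one₀ hp0.le hp1.le)).trans_lt hx1
    have h := hasSum_le (fun n => ?_) (hb.mul_right
      (rescaledMittagLeffler q α 0 ((q ^ α) ^ m * x))) (hrel _ hpx1)
    · by_contra! hneg
      nlinarith
    · rw [← mul_assoc, ← pow_add]
      exact mul_le_mul_of_nonneg_left (hmin _) (hb0 n)

theorem rescaledMittagLeffler_le_rpow_mul {q α x : ℝ} (hq0 : 0 < q) (hq1 : q < 1) (hα0 : 0 < α)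
    (hα1 : α < 1) (hx0 : 0 ≤ x) (hx1 : x < 1) :
    rescaledMittagLeffler q α 0 x ≤ rescaledMittagLeffler q α 0 (q ^ α * x) := by
  obtain ⟨b, hb0, hb, hrel⟩ := exists_relaxation_weights hq0 hq1 hα0 hα1
  have hp0 : 0 < q ^ α := Real.rpow_pos_of_pos hq0 α
  have hp1 : q ^ α < 1 := Real.rpow_lt_one hq0.le hq1 hα0
  have hd := qFactorialRatio_pos hq0 hq1 (show 0 < 1 - α by linarith)
  have hxa : |x| < 1 := by rwa [abs_of_nonneg hx0]
  have hlim := tendsto_rescaledMittagLeffler (s := 0) hq0 hq1 hα0.le (by norm_num) hxa hp0.le hp1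
  have hlim' := ((Filter.tendsto_add_atTop_iff_nat 1).2 hlim).sub hlim
  have h0 := nonneg_of_tendsto_of_not_min hlim' (sub_self _).ge (fun m hmin => ?_) 0
  · simpa using h0
  · have hlt : ∀ j, 0 ≤ (q ^ α) ^ j * x ∧ (q ^ α) ^ j * x < 1 := fun j =>
      ⟨by positivity, (mul_le_of_le_one_left hx0 (pow_le_one₀ hp0.le hp1.le)).trans_lt hx1⟩
    have habs : ∀ j, |(q ^ α) ^ j * x| < 1 := fun j => by
      rw [abs_of_nonneg (hlt j).1]; exact (hlt j).2
    have h := hasSum_le (fun n => ?_) (hb.mul_right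
      (rescaledMittagLeffler q α 0 ((q ^ α) ^ (m + 1) * x) -
        rescaledMittagLeffler q α 0 ((q ^ α) ^ m * x)))
      ((hrel _ (habs (m + 1))).sub (hrel _ (habs m)))
    · have hu := rescaledMittagLeffler_nonneg hq0 hq1 hα0 hα1 (hlt m).1 (hlt m).2
      have hy := (hlt (m + 1)).1
      have hstep : (q ^ α) ^ (m + 1) * x ≤ (q ^ α) ^ m * x :=
        mul_le_mul_of_nonneg_right (pow_le_pow_of_le_one hp0.le hp1.le m.le_succ) hx0
      have hprod := mul_nonneg (sub_nonneg.2 hstep) hu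
      by_contra! hneg
      nlinarith
    · rw [← mul_assoc, ← mul_assoc, ← pow_add, ← pow_add, ← mul_sub]
      have := hmin (n + 1 + m)
      rw [add_assoc] at this
      exact mul_le_mul_of_nonneg_left this (hb0 n)

theorem rescaledMittagLeffler_le_rpow_pow_mul {q α x : ℝ} (hq0 : 0 < q) (hq1 : q < 1)
    (hα0 : 0 < α) (hα1 : α < 1) (hx0 : 0 ≤ x) (hx1 : x < 1) (n : ℕ) :
    rescaledMittagLeffler q α 0 x ≤ rescaledMittagLeffler q α 0 ((q ^ α) ^ n * x) := by
  have hp0 : 0 < q ^ α := Real.rpow_pos_of_pos hq0 α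
  have hp1 : q ^ α < 1 := Real.rpow_lt_one hq0.le hq1 hα0
  induction n with
  | zero => simp
  | succ n ih =>
    rw [pow_succ', mul_assoc]
    exact ih.trans (rescaledMittagLeffler_le_rpow_mul hq0 hq1 hα0 hα1 (by positivity)
      ((mul_le_of_le_one_left hx0 (pow_le_one₀ hp0.le hp1.le)).trans_lt hx1))

/-! ### The two-sided bound -/

theorem le_rescaledMittagLeffler {q α x : ℝ} (hq0 : 0 < q) (hq1 : q < 1) (hα0 : 0 < α)
    (hα1 : α < 1) (hx0 : 0 ≤ x) (hx1 : x < 1) :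
    1 / (1 + (qFactorialRatio q (1 - α))⁻¹ * x) ≤ rescaledMittagLeffler q α 0 x := by
  obtain ⟨b, hb0, hb, hrel⟩ := exists_relaxation_weights hq0 hq1 hα0 hα1
  have hd := qFactorialRatio_pos hq0 hq1 (show 0 < 1 - α by linarith)
  have h := hasSum_le (fun n => mul_le_mul_of_nonneg_left
    (rescaledMittagLeffler_le_rpow_pow_mul hq0 hq1 hα0 hα1 hx0 hx1 (n + 1)) (hb0 n))
    (hb.mul_right (rescaledMittagLeffler q α 0 x)) (hrel x (by rwa [abs_of_nonneg hx0]))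
  rw [div_le_iff₀ (by positivity)]
  refine le_of_mul_le_mul_left ?_ hd
  field_simp
  linarith

theorem rescaledMittagLeffler_le {q α x : ℝ} (hq0 : 0 < q) (hq1 : q < 1) (hα0 : 0 < α)
    (hα1 : α < 1) (hx0 : 0 ≤ x) (hx1 : x < 1) :
    rescaledMittagLeffler q α 0 x ≤ 1 / (1 + qFactorialRatio q (1 + α) * x) := by
  have hc := qFactorialRatio_pos hq0 hq1 (show 0 < 1 + α by linarith)
  have hxa : |x| < 1 := by rwa [abs_of_nonneg hx0]
  have hint (y : ℝ) (hy : |y| < 1) :=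
    hasSum_qBinomialCoeff_mul_rescaledMittagLeffler (s := α) hq0 hq1 hα0.le hy
  have hw : HasSum (fun n : ℕ => qBinomialCoeff (q ^ α) q n * q ^ n)
      (qFactorialRatio q (1 + α)) := by
    simpa [rescaledMittagLeffler_zero, qFactorialRatio_one hq0 hq1] using hint 0 (by simp)
  have h := hasSum_le (fun n => mul_le_mul_of_nonneg_left
    (rescaledMittagLeffler_le_rpow_pow_mul hq0 hq1 hα0 hα1 hx0 hx1 n)
    (mul_nonneg (qBinomialCoeff_nonneg hq0 hq1 (Real.rpow_pos_of_pos hq0 α).le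
      (Real.rpow_le_one hq0.le hq1.le hα0.le) n) (pow_nonneg hq0.le n)))
    (hw.mul_right (rescaledMittagLeffler q α 0 x)) (hint x hxa)
  have heq := rescaledMittagLeffler_eq_sub (s := 0) hq0 hq1 hα0.le (by norm_num) hxa
  rw [add_zero, zero_add, qFactorialRatio_one hq0 hq1] at heq
  rw [le_div_iff₀ (by positivity)]
  have := mul_le_mul_of_nonneg_left h hx0
  linarith

theorem lemma3p1 (q α z : ℝ) (hq0 : 0 < q) (hq1 : q < 1) (hα0 : 0 < α) (hα1 : α < 1)
    (hz : 0 < z) (hconv : |z * (1 - q) ^ α| < 1) :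
    (1 / (1 + qGamma q (1 - α) * z) ≤ qMittagLeffler α 1 (-z) q ∧
      qMittagLeffler α 1 (-z) q ≤ 1 / (1 + (qGamma q (α + 1))⁻¹ * z)) ∧
    (0 < qMittagLeffler α 1 (-z) q ∧ qMittagLeffler α 1 (-z) q < 1) := by
  have hq : 0 < 1 - q := by linarith
  have hx0 : 0 < z * (1 - q) ^ α := by positivity
  have hx1 : z * (1 - q) ^ α < 1 := (abs_lt.1 hconv).2
  have hd := qFactorialRatio_pos hq0 hq1 (show 0 < 1 - α by linarith)
  have hc := qFactorialRatio_pos hq0 hq1 (show 0 < 1 + α by linarith)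
  have hlow : qGamma q (1 - α) * z = (qFactorialRatio q (1 - α))⁻¹ * (z * (1 - q) ^ α) := by
    rw [← inv_inv (qGamma q (1 - α)), inv_qGamma hq1, mul_inv, ← Real.rpow_neg hq.le,
      show -(1 - α - 1) = α by ring]
    ring
  have hupp : (qGamma q (α + 1))⁻¹ * z = qFactorialRatio q (1 + α) * (z * (1 - q) ^ α) := by
    rw [inv_qGamma hq1, add_sub_cancel_right, add_comm α]
    ring
  have h1 := le_rescaledMittagLeffler hq0 hq1 hα0 hα1 hx0.le hx1
  have h2 := rescaledMittagLeffler_le hq0 hq1 hα0 hα1 hx0.le hx1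
  rw [qMittagLeffler_neg_eq hq1, hlow, hupp]
  refine ⟨⟨h1, h2⟩, lt_of_lt_of_le (by positivity) h1, h2.trans_lt ?_⟩
  rw [div_lt_one (by positivity)]
  have := mul_pos hc hx0
  linarith
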